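/- **Conventions.** A signed graph is a finite simple graph together with a sign $+1$ or $-1$ on each edge. Its Laplacian matrix is $L(\Gamma)=D-A(\Gamma)$, where $D$ is the diagonal matrix of the vertex degrees of the underlying graph and $A(\Gamma)$ is the signed adjacency matrix (entry $\pm1$ according to the sign of the edge, $0$ if there is no edge). Two signed graphs are Laplacian cospectral if their Laplacian matrices have the same eigenvalues with the same multiplicities, and isomorphic if there is a bijection of the vertex sets preserving edges, non-edges and signs. For a signed graph on $\{u_1,\dots,u_n\}\cup\{v_1,\dots,v_n\}$, the partial transpose $\Gamma^\tau$ is obtained by replacing every edge $(u_k,v_l)$ by the edge $(u_l,v_k)$ of the same sign, keeping all edges among the $u$'s and among the $v$'s. A bar denotes a negative edge; edges without a bar are positive. **Theorem 3.2.** Let $n\ge 3$ and let $\Gamma$ be the disjoint union of the two all-positive $n$-cycles $u_1u_2\cdots u_nu_1$ and $v_1v_2\cdots v_nv_1$. Let $u_i,u_j$ with $i<j$ be non-adjacent in $\Gamma$, and let $$\Gamma_1=\Gamma+\{(u_i,u_j),\overline{(u_i,v_i)},(u_i,v_j)\}.$$ (i) $\Gamma_1$ and its partial transpose $\Gamma_1^\tau$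 are non-isomorphic and Laplacian cospectral. (ii) If $j<n$, then the signed graphs $$\Gamma_2=\Gamma_1-\{(u_{n-1},u_n),\overline{(u_i,v_i)},(u_{j-1},u_j)\}+\{\overline{(u_{n-1},u_n)},(u_i,v_i),\overline{(u_{j-1},u_j)}\},$$ $$\Gamma_3=\Gamma_1^\tau-\{(u_{n-1},u_n),(u_{j-1},u_j)\}+\{\overline{(u_{n-1},u_n)},\overline{(u_{j-1},u_j)}\}$$ are non-isomorphic and Laplacian cospectral. (iii) If $j<n$, then the signed graphs $$\Gamma_4=\Gamma_1-\{(v_{n-1},v_n),\overline{(u_i,v_i)},(u_{j-1},u_j)\}+\{\overline{(v_{n-1},v_n)},(u_i,v_i),\overline{(u_{j-1},u_j)}\},$$ $$\Gamma_5=\Gamma_1^\tau-\{(v_{n-1},v_n),(u_{j-1},u_j)\}+\{\overline{(v_{n-1},v_n)},\overline{(u_{j-1},u_j)}\}$$ are non-isomorphic and Laplacian cospectral. -/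

import Mathlib

/-- A signed graph `Γ = (G, σ)` on the vertex set `V`: a simple graph `graph` together with a sign
`+1` or `-1` on each edge. The sign function is extended by `0` to the pairs of vertices that are
not joined by an edge, so `sign a b` is `1` on positive edges, `-1` on negative edges and `0`
otherwise. -/
structure SignedGraph (V : Type*) where
  /-- The underlying simple graph. -/
  graph : SimpleGraph V
  /-- The sign of an edge (`0` for pairs that are not edges). -/
  sign : V → V → SignType
  sign_symm : ∀ a b, sign a b = sign b a
  sign_ne_zero : ∀ a b, sign a b ≠ 0 ↔ graph.Adj a b

namespace SignedGraph

instance {V : Type*} (Γ : SignedGraph V) : DecidableRel Γ.graph.Adj :=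
  fun a b => decidable_of_iff _ (Γ.sign_ne_zero a b)

/-- The signed graph whose edges are the pairs with `s a b ≠ 0`, with `s a b` as sign. -/
def ofSign {V : Type*} (s : V → V → SignType) (symm : ∀ a b, s a b = s b a)
    (loopless : ∀ a, s a a = 0) : SignedGraph V where
  graph :=
    { Adj := fun a b => s a b ≠ 0
      symm := ⟨fun a b h => by rwa [symm b a]⟩
      loopless := ⟨fun a h => h (loopless a)⟩ }
  sign := s
  sign_symm := symm
  sign_ne_zero := fun _ _ => Iff.rfl

/-- The all-positive signed graph on a given simple graph. -/
def allPositive {V : Type*} (G : SimpleGraph V) [DecidableRel G.Adj] : SignedGraph V where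
  graph := G
  sign := fun a b => if G.Adj a b then 1 else 0
  sign_symm := fun a b => by simp only [G.adj_comm]
  sign_ne_zero := fun a b => by simp

/-- Two signed graphs are isomorphic if there is a bijection of their vertex sets that maps
positive edges to positive edges, negative edges to negative edges and non-edges to non-edges. -/
def Isomorphic {V W : Type*} (Γ : SignedGraph V) (Δ : SignedGraph W) : Prop :=
  ∃ e : V ≃ W, ∀ a b, Δ.sign (e a) (e b) = Γ.sign a b

/-- The signed adjacency matrix `A(Γ)`. -/
def adjacency {V : Type*} (Γ : SignedGraph V) : Matrix V V ℝ :=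
  Matrix.of fun a b => (Γ.sign a b : ℝ)

/-- The Laplacian matrix `L(Γ) = D(G) - A(Γ)`, where `D(G)` is the diagonal matrix of the vertex
degrees of the underlying graph. -/
def laplacian {V : Type*} [Fintype V] [DecidableEq V] (Γ : SignedGraph V) : Matrix V V ℝ :=
  Γ.graph.degMatrix ℝ - Γ.adjacency

/-- The Laplacian spectrum: the eigenvalues of `L(Γ)` with multiplicity, that is, the multiset of
roots of `det (x I - L(Γ))`. -/
noncomputable def laplacianSpectrum {V : Type*} [Fintype V] [DecidableEq V] (Γ : SignedGraph V) :
    Multiset ℝ :=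
  Γ.laplacian.charpoly.roots

/-- Two signed graphs are Laplacian cospectral if they have the same Laplacian spectrum. -/
def LaplacianCospectral {V W : Type*} [Fintype V] [DecidableEq V] [Fintype W] [DecidableEq W]
    (Γ : SignedGraph V) (Δ : SignedGraph W) : Prop :=
  Γ.laplacianSpectrum = Δ.laplacianSpectrum

/-- Give the pair `{a, b}` of distinct vertices the sign `ε` (which means no edge if `ε = 0`) and
leave all other pairs unchanged. -/
def setSign {V : Type*} [DecidableEq V] (Γ : SignedGraph V) (a b : V) (ε : SignType) :
    SignedGraph V :=
  ofSign (fun x y => if x ≠ y ∧ s(x, y) = s(a, b) then ε else Γ.sign x y)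
    (fun x y => by simp only [ne_comm (a := x), Sym2.eq_swap (a := x), Γ.sign_symm x])
    (fun x => by
      have h := Γ.sign_ne_zero x x
      simp only [SimpleGraph.irrefl, iff_false, not_not] at h
      simp [h])

/-- `Γ + {(a, b)}`: add the positive edge `(a, b)`. -/
def addPos {V : Type*} [DecidableEq V] (Γ : SignedGraph V) (a b : V) : SignedGraph V :=
  Γ.setSign a b 1

/-- Add the negative edge `(a, b)`. -/
def addNeg {V : Type*} [DecidableEq V] (Γ : SignedGraph V) (a b : V) : SignedGraph V :=
  Γ.setSign a b (-1)

/-- `Γ - {(a, b)}`: remove the edge `(a, b)`, whatever its sign. -/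
def deleteEdge {V : Type*} [DecidableEq V] (Γ : SignedGraph V) (a b : V) : SignedGraph V :=
  Γ.setSign a b 0

/-- The partial transpose of a signed graph with vertex set `V₁ ∪ V₂`, where
`V₁ = {u k} = {inl k}` and `V₂ = {v k} = {inr k}`: the edges inside `V₁` and inside `V₂` are kept,
and each edge `(u k, v l)` is replaced by the edge `(u l, v k)` of the same sign. -/
def partialTranspose {ι : Type*} (Γ : SignedGraph (ι ⊕ ι)) : SignedGraph (ι ⊕ ι) :=
  ofSign
    (fun x y => match x, y with
      | .inl k, .inr l => Γ.sign (.inl l) (.inr k)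
      | .inr l, .inl k => Γ.sign (.inr k) (.inl l)
      | .inl k, .inl l => Γ.sign (.inl k) (.inl l)
      | .inr k, .inr l => Γ.sign (.inr k) (.inr l))
    (fun x y => by rcases x with x | x <;> rcases y with y | y <;> exact Γ.sign_symm _ _)
    (fun x => by
      rcases x with x | x
      · simpa using Γ.sign_ne_zero (.inl x) (.inl x)
      · simpa using Γ.sign_ne_zero (.inr x) (.inr x))

/-- The vertex `u`; the labels `1, …, n` are represented by the elements `0, …, n - 1` of
`Fin n`. -/
abbrev u {n : ℕ} (k : Fin n) : Fin n ⊕ Fin n := Sum.inl k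

/-- The vertex `v`, labelled like `u`. -/
abbrev v {n : ℕ} (k : Fin n) : Fin n ⊕ Fin n := Sum.inr k

/-- The signed graph `Γ`: two disjoint all-positive cycles `u_1 u_2 … u_n u_1` and
`v_1 v_2 … v_n v_1` on `n` vertices each, without edges between them. -/
def twoCycles (n : ℕ) : SignedGraph (Fin n ⊕ Fin n) where
  graph := SimpleGraph.cycleGraph n ⊕g SimpleGraph.cycleGraph n
  sign := fun x y => match x, y with
    | .inl k, .inl l => (allPositive (SimpleGraph.cycleGraph n)).sign k l
    | .inr k, .inr l => (allPositive (SimpleGraph.cycleGraph n)).sign k l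
    | _, _ => 0
  sign_symm := fun x y => by
    rcases x with x | x <;> rcases y with y | y <;> first | rfl | exact sign_symm _ _ _
  sign_ne_zero := fun x y => by
    rcases x with x | x <;> rcases y with y | y <;> simp [SimpleGraph.sum, allPositive]

/-- The label of `u_{n-1}` and `v_{n-1}`, given that there is some label `k`. -/
abbrev secondLast {n : ℕ} (k : Fin n) : Fin n := ⟨n - 2, by have := k.isLt; omega⟩

/-- The label of `u_n` and `v_n`, given that there is some label `k`. -/
abbrev last {n : ℕ} (k : Fin n) : Fin n := ⟨n - 1, by have := k.isLt; omega⟩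

/-- The label that precedes `j`, for `j` not the first label. -/
abbrev prev {n : ℕ} (j : Fin n) : Fin n := ⟨j - 1, by have := j.isLt; omega⟩

/-- `Γ₁`: add to `Γ` the edges `(u_i, u_j)`, `(u_i, v_i)` (negative) and `(u_i, v_j)`. -/
def gamma1 {n : ℕ} (i j : Fin n) : SignedGraph (Fin n ⊕ Fin n) :=
  (((twoCycles n).addPos (u i) (u j)).addNeg (u i) (v i)).addPos (u i) (v j)

/-- `Γ₂`: in `Γ₁`, the edges `(u_{n-1}, u_n)` and `(u_{j-1}, u_j)` become negative and the edge
`(u_i, v_i)` becomes positive. -/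
def gamma2 {n : ℕ} (i j : Fin n) : SignedGraph (Fin n ⊕ Fin n) :=
  ((((((gamma1 i j).deleteEdge (u (secondLast i)) (u (last i))).deleteEdge (u i) (v i)).deleteEdge
    (u (prev j)) (u j)).addNeg (u (secondLast i)) (u (last i))).addPos (u i) (v i)).addNeg
    (u (prev j)) (u j)

/-- `Γ₃`: in the partial transpose of `Γ₁`, the edges `(u_{n-1}, u_n)` and `(u_{j-1}, u_j)` become
negative. -/
def gamma3 {n : ℕ} (i j : Fin n) : SignedGraph (Fin n ⊕ Fin n) :=
  (((((gamma1 i j).partialTranspose).deleteEdge (u (secondLast i)) (u (last i))).deleteEdge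
    (u (prev j)) (u j)).addNeg (u (secondLast i)) (u (last i))).addNeg (u (prev j)) (u j)

/-- `Γ₄`: in `Γ₁`, the edges `(v_{n-1}, v_n)` and `(u_{j-1}, u_j)` become negative and the edge
`(u_i, v_i)` becomes positive. -/
def gamma4 {n : ℕ} (i j : Fin n) : SignedGraph (Fin n ⊕ Fin n) :=
  ((((((gamma1 i j).deleteEdge (v (secondLast i)) (v (last i))).deleteEdge (u i) (v i)).deleteEdge
    (u (prev j)) (u j)).addNeg (v (secondLast i)) (v (last i))).addPos (u i) (v i)).addNeg
    (u (prev j)) (u j)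

/-- `Γ₅`: in the partial transpose of `Γ₁`, the edges `(v_{n-1}, v_n)` and `(u_{j-1}, u_j)` become
negative. -/
def gamma5 {n : ℕ} (i j : Fin n) : SignedGraph (Fin n ⊕ Fin n) :=
  (((((gamma1 i j).partialTranspose).deleteEdge (v (secondLast i)) (v (last i))).deleteEdge
    (u (prev j)) (u j)).addNeg (v (secondLast i)) (v (last i))).addNeg (u (prev j)) (u j)

end SignedGraph

open SignedGraph Matrix

/-- The contribution of an edge of sign `ε` between `a` and `b` to the Laplacian matrix. -/
def edgeLaplacian {V : Type*} [DecidableEq V] (a b : V) (ε : ℝ) : Matrix V V ℝ :=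
  Matrix.of fun x y =>
    if x = y then (if x = a then ε ^ 2 else 0) + (if x = b then ε ^ 2 else 0)
    else if (x = a ∧ y = b) ∨ (x = b ∧ y = a) then -ε else 0

theorem SignedGraph.laplacian_apply {V : Type*} [Fintype V] [DecidableEq V] (Γ : SignedGraph V)
    (x y : V) : Γ.laplacian x y =
      if x = y then ∑ z, (Γ.sign x z : ℝ) ^ 2 else -(Γ.sign x y : ℝ) := by
  have hs : Γ.sign x x = 0 := by
    have h := Γ.sign_ne_zero x x
    simpa using h
  have key : ((Γ.graph.degree x : ℕ) : ℝ) = ∑ z, (Γ.sign x z : ℝ) ^ 2 := by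
    rw [← SimpleGraph.card_neighborFinset_eq_degree, SimpleGraph.neighborFinset_eq_filter,
      Finset.card_filter, Nat.cast_sum]
    refine Finset.sum_congr rfl fun z _ => ?_
    have hxz := Γ.sign_ne_zero x z
    cases h : Γ.sign x z <;> simp [← hxz, h]
  by_cases hxy : x = y
  · subst hxy
    simp [laplacian, adjacency, SimpleGraph.degMatrix, hs, key]
  · simp [laplacian, adjacency, SimpleGraph.degMatrix, hxy]

theorem SignedGraph.sign_setSign {V : Type*} [DecidableEq V] (Γ : SignedGraph V) (a b : V)
    (ε : SignType) (x y : V) : (Γ.setSign a b ε).sign x y =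
      if x ≠ y ∧ s(x, y) = s(a, b) then ε else Γ.sign x y := rfl

theorem SignedGraph.laplacian_setSign {V : Type*} [Fintype V] [DecidableEq V] (Γ : SignedGraph V)
    {a b : V} (hab : a ≠ b) (ε : SignType) :
    (Γ.setSign a b ε).laplacian =
      Γ.laplacian - edgeLaplacian a b (Γ.sign a b : ℝ) + edgeLaplacian a b (ε : ℝ) := by
  have hs : ∀ x z, ((Γ.setSign a b ε).sign x z : ℝ) ^ 2 = (Γ.sign x z : ℝ) ^ 2 +
      ((if x = a then (if z = b then (ε : ℝ) ^ 2 - (Γ.sign a b : ℝ) ^ 2 else 0) else 0) +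
      (if x = b then (if z = a then (ε : ℝ) ^ 2 - (Γ.sign a b : ℝ) ^ 2 else 0) else 0)) := by
    intro x z
    rw [sign_setSign]
    have := Γ.sign_symm a b
    simp only [Sym2.eq_iff]
    split_ifs <;> simp_all
  ext x y
  by_cases hxy : x = y
  · subst hxy
    simp only [Matrix.add_apply, Matrix.sub_apply, laplacian_apply, edgeLaplacian, Matrix.of_apply,
      if_true, hs, Finset.sum_add_distrib]
    by_cases h1 : x = a <;> by_cases h2 : x = b <;> simp [h1, h2, hab, hab.symm] <;> ring
  · simp only [Matrix.add_apply, Matrix.sub_apply, laplacian_apply, edgeLaplacian, Matrix.of_apply,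
      if_neg hxy, sign_setSign]
    by_cases h : (x = a ∧ y = b) ∨ (x = b ∧ y = a)
    · rw [if_pos ⟨hxy, Sym2.eq_iff.2 h⟩, if_pos h, if_pos h]
      rcases h with ⟨rfl, rfl⟩ | ⟨rfl, rfl⟩
      · ring
      · rw [Γ.sign_symm y x]; ring
    · rw [if_neg fun h' => h (Sym2.eq_iff.1 h'.2), if_neg h, if_neg h]
      ring

theorem edgeLaplacian_zero {V : Type*} [DecidableEq V] (a b : V) : edgeLaplacian a b 0 = 0 := by
  ext x y; simp [edgeLaplacian]

theorem edgeLaplacian_eq_vecMulVec {V : Type*} [DecidableEq V] {a b : V} (hab : a ≠ b) {ε : ℝ}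
    (hε : ε ^ 2 = 1) : edgeLaplacian a b ε =
      vecMulVec (Pi.single a 1 - ε • Pi.single b 1) (Pi.single a 1 - ε • Pi.single b 1) := by
  ext x y
  simp only [edgeLaplacian, of_apply, vecMulVec_apply, Pi.sub_apply, Pi.smul_apply, smul_eq_mul,
    Pi.single_apply]
  split_ifs <;> simp_all; nlinarith

theorem diagonal_mul_edgeLaplacian_mul_diagonal {V : Type*} [Fintype V] [DecidableEq V]
    {a b : V} (hab : a ≠ b) (ε : ℝ) {d : V → ℝ} (hd : ∀ x, d x * d x = 1) :
    diagonal d * edgeLaplacian a b ε * diagonal d = edgeLaplacian a b (d a * d b * ε) := by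
  ext x y
  rw [mul_diagonal, diagonal_mul]
  have ha := hd a
  have hb := hd b
  have h2 : (d a * d b * ε) ^ 2 = ε ^ 2 := by
    calc _ = (d a * d a) * (d b * d b) * ε ^ 2 := by ring
      _ = _ := by rw [ha, hb]; ring
  simp only [edgeLaplacian, of_apply, h2]
  by_cases hxy : x = y
  · subst hxy
    simp only [if_true]
    rw [mul_right_comm, hd, one_mul]
  · simp only [if_neg hxy]
    by_cases h : (x = a ∧ y = b) ∨ (x = b ∧ y = a)
    · simp only [if_pos h]
      rcases h with ⟨rfl, rfl⟩ | ⟨rfl, rfl⟩ <;> ring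
    · simp [if_neg h]

theorem Matrix.charpoly_eq_of_conj {V : Type*} [Fintype V] [DecidableEq V]
    {A B Q : Matrix V V ℝ} (hQ : Q * Q = 1) (h : Q * A * Q = B) : A.charpoly = B.charpoly := by
  rw [← h]
  rw [charpoly_mul_comm, ← Matrix.mul_assoc, hQ, Matrix.one_mul]

/-- An isomorphism preserves the diagonal entries of the Laplacian matrix, the degrees. -/
theorem SignedGraph.Isomorphic.exists_laplacian_diag {V W : Type*} [Fintype V] [DecidableEq V]
    [Fintype W] [DecidableEq W] {Γ : SignedGraph V} {Δ : SignedGraph W} (h : Γ.Isomorphic Δ)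
    (x : V) : ∃ y, Δ.laplacian y y = Γ.laplacian x x := by
  obtain ⟨e, he⟩ := h
  refine ⟨e x, ?_⟩
  simp only [laplacian_apply, if_true]
  rw [← e.sum_comp]
  simp [he]

/-- If `P` is a symmetric involution that commutes with `Y` and maps the `i`-th basis vector to `η`
times the `j`-th, then the two perturbations of `Y ⊕ Y` below are similar by the involution that
interchanges the two summands on the `1`-eigenspace of `P` and is the identity on the
`-1`-eigenspace. -/
theorem charpoly_interchange {ι : Type*} [Fintype ι] [DecidableEq ι] {Y P : Matrix ι ι ℝ}
    (hPT : Pᵀ = P) (hPP : P * P = 1) (hYP : P * Y = Y * P) {i j : ι} (hij : i ≠ j) {η : ℝ}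
    (hη : η ^ 2 = 1) (hi : P *ᵥ Pi.single i 1 = η • Pi.single j 1) :
    (fromBlocks Y 0 0 Y + edgeLaplacian (Sum.inl i) (Sum.inl j) η +
      edgeLaplacian (Sum.inl i) (Sum.inr i) (-1) + edgeLaplacian (Sum.inl i) (Sum.inr j) η).charpoly =
    (fromBlocks Y 0 0 Y + edgeLaplacian (Sum.inl i) (Sum.inl j) η +
      edgeLaplacian (Sum.inl i) (Sum.inr i) (-1) + edgeLaplacian (Sum.inl j) (Sum.inr i) η).charpoly := by
  have hj : P *ᵥ Pi.single j 1 = η • Pi.single i 1 := by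
    have := congrArg (fun w => η • P *ᵥ w) hi
    simp only [mulVec_mulVec, hPP, one_mulVec, mulVec_smul, smul_smul] at this
    rw [← pow_two, hη, one_smul] at this
    exact this.symm
  set Q : Matrix (ι ⊕ ι) (ι ⊕ ι) ℝ :=
    (1 / 2 : ℝ) • fromBlocks (1 - P) (1 + P) (1 + P) (1 - P) with hQ
  have hQT : Qᵀ = Q := by
    simp [hQ, fromBlocks_transpose, hPT]
  have hQQ : Q * Q = 1 := by
    rw [hQ, smul_mul_smul_comm, fromBlocks_multiply, ← fromBlocks_one, fromBlocks_smul]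
    have e1 : (1 - P) * (1 - P) + (1 + P) * (1 + P) = (4 : ℝ) • (1 : Matrix ι ι ℝ) := by
      simp only [Matrix.sub_mul, Matrix.mul_sub, Matrix.add_mul, Matrix.mul_add, Matrix.one_mul,
        Matrix.mul_one, hPP]
      module
    have e2 : (1 - P) * (1 + P) + (1 + P) * (1 - P) = 0 := by
      simp only [Matrix.sub_mul, Matrix.mul_sub, Matrix.add_mul, Matrix.mul_add, Matrix.one_mul,
        Matrix.mul_one, hPP]
      module
    have e3 : (1 + P) * (1 - P) + (1 - P) * (1 + P) = 0 := by rw [add_comm, e2]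
    have e4 : (1 + P) * (1 + P) + (1 - P) * (1 - P) = (4 : ℝ) • (1 : Matrix ι ι ℝ) := by
      rw [add_comm, e1]
    rw [e1, e2, e3, e4]
    simp only [smul_smul, smul_zero]
    norm_num
  have hQB : Q * fromBlocks Y 0 0 Y = fromBlocks Y 0 0 Y * Q := by
    rw [hQ, Matrix.smul_mul, Matrix.mul_smul]
    simp only [fromBlocks_multiply, Matrix.mul_zero, Matrix.zero_mul, add_zero, zero_add, sub_zero,
      Matrix.sub_mul, Matrix.mul_sub, Matrix.add_mul, Matrix.mul_add, hYP, Matrix.one_mul,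
      Matrix.mul_one]
  have hvv : ∀ w : ι ⊕ ι → ℝ, Q * vecMulVec w w * Q = vecMulVec (Q *ᵥ w) (Q *ᵥ w) := by
    intro w
    rw [mul_vecMulVec, vecMulVec_mul]
    congr 1
    rw [← mulVec_transpose, hQT]
  have hη' : η * η = 1 := by rw [← pow_two, hη]
  have hQl : ∀ k, Q *ᵥ Pi.single (Sum.inl k) 1 = (1 / 2 : ℝ) •
      Sum.elim (Pi.single k 1 - P *ᵥ Pi.single k 1) (Pi.single k 1 + P *ᵥ Pi.single k 1) := by
    intro k
    rw [hQ, smul_mulVec,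
      show (Pi.single (Sum.inl k) 1 : ι ⊕ ι → ℝ) = Sum.elim (Pi.single k 1) 0 by simp,
      fromBlocks_mulVec]
    simp only [Sum.elim_comp_inl, Sum.elim_comp_inr, mulVec_zero, add_zero, sub_mulVec, add_mulVec,
      one_mulVec]
  have hQr : ∀ k, Q *ᵥ Pi.single (Sum.inr k) 1 = (1 / 2 : ℝ) •
      Sum.elim (Pi.single k 1 + P *ᵥ Pi.single k 1) (Pi.single k 1 - P *ᵥ Pi.single k 1) := by
    intro k
    rw [hQ, smul_mulVec,
      show (Pi.single (Sum.inr k) 1 : ι ⊕ ι → ℝ) = Sum.elim (0 : ι → ℝ) (Pi.single k 1) by simp,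
      fromBlocks_mulVec]
    simp only [Sum.elim_comp_inl, Sum.elim_comp_inr, mulVec_zero, zero_add, sub_mulVec, add_mulVec,
      one_mulVec]
  have sll : ∀ k x, (Pi.single (Sum.inl k) 1 : ι ⊕ ι → ℝ) (Sum.inl x) = (Pi.single k 1 : ι → ℝ) x :=
    fun k x => by simp [Pi.single_apply]
  have srr : ∀ k x, (Pi.single (Sum.inr k) 1 : ι ⊕ ι → ℝ) (Sum.inr x) = (Pi.single k 1 : ι → ℝ) x :=
    fun k x => by simp [Pi.single_apply]
  have slr : ∀ k x, (Pi.single (Sum.inl k) 1 : ι ⊕ ι → ℝ) (Sum.inr x) = 0 := fun k x => by simp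
  have srl : ∀ k x, (Pi.single (Sum.inr k) 1 : ι ⊕ ι → ℝ) (Sum.inl x) = 0 := fun k x => by simp
  refine charpoly_eq_of_conj hQQ ?_
  simp only [Matrix.mul_add, Matrix.add_mul]
  rw [hQB, Matrix.mul_assoc, hQQ, Matrix.mul_one,
    edgeLaplacian_eq_vecMulVec (a := Sum.inl i) (b := Sum.inl j) (by simpa using hij) hη,
    edgeLaplacian_eq_vecMulVec (a := Sum.inl i) (b := Sum.inr i) (by simp) (by norm_num),
    edgeLaplacian_eq_vecMulVec (a := Sum.inl i) (b := Sum.inr j) (by simp) hη,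
    edgeLaplacian_eq_vecMulVec (a := Sum.inl j) (b := Sum.inr i) (by simp) hη, hvv, hvv, hvv]
  have h1 : Q *ᵥ (Pi.single (Sum.inl i) 1 - η • Pi.single (Sum.inl j) 1) =
      Pi.single (Sum.inl i) 1 - η • Pi.single (Sum.inl j) 1 := by
    rw [mulVec_sub, mulVec_smul, hQl, hQl, hi, hj]
    ext (x | x) <;> simp only [Pi.sub_apply, Pi.add_apply, Pi.smul_apply, smul_eq_mul,
      Sum.elim_inl, Sum.elim_inr, sll, slr]
    · linear_combination ((1 / 2) * (Pi.single i 1 : ι → ℝ) x) * hη'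
    · linear_combination (-(1 / 2) * (Pi.single i 1 : ι → ℝ) x) * hη'
  have h2 : Q *ᵥ (Pi.single (Sum.inl i) 1 - (-1 : ℝ) • Pi.single (Sum.inr i) 1) =
      Pi.single (Sum.inl i) 1 - (-1 : ℝ) • Pi.single (Sum.inr i) 1 := by
    rw [mulVec_sub, mulVec_smul, hQl, hQr, hi]
    ext (x | x) <;> simp only [Pi.sub_apply, Pi.add_apply, Pi.smul_apply, smul_eq_mul,
      Sum.elim_inl, Sum.elim_inr, sll, srr, slr, srl]
    · ring
    · ring
  have h3 : Q *ᵥ (Pi.single (Sum.inl i) 1 - η • Pi.single (Sum.inr j) 1) =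
      (-η) • (Pi.single (Sum.inl j) 1 - η • Pi.single (Sum.inr i) 1) := by
    rw [mulVec_sub, mulVec_smul, hQl, hQr, hi, hj]
    ext (x | x) <;> simp only [Pi.sub_apply, Pi.add_apply, Pi.smul_apply, smul_eq_mul,
      Sum.elim_inl, Sum.elim_inr, sll, srr, slr, srl]
    · linear_combination (-(1 / 2) * (Pi.single i 1 : ι → ℝ) x) * hη'
    · linear_combination (-(1 / 2) * (Pi.single i 1 : ι → ℝ) x) * hη'
  rw [h1, h2, h3, smul_vecMulVec, vecMulVec_smul, smul_smul, neg_mul_neg, hη', one_smul]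

/-- The Laplacian matrix of the signed cycle `0, 1, …, n - 1` in which the edge joining `n - 1` to
`0` has sign `ε` and all other edges are positive. -/
def cycleLaplacian (n : ℕ) (ε : ℝ) : Matrix (Fin n) (Fin n) ℝ :=
  Matrix.of fun k l =>
    if k = l then 2
    else if (k : ℕ) + 1 = l ∨ (l : ℕ) + 1 = k then -1
    else if ((k : ℕ) = 0 ∧ (l : ℕ) + 1 = n) ∨ ((l : ℕ) = 0 ∧ (k : ℕ) + 1 = n) then -ε
    else 0

/-- The reflection of the cycle `0, 1, …, n - 1` that interchanges `i` and `j`. -/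
def reflect {n : ℕ} (i j k : Fin n) : Fin n :=
  ⟨if (i : ℕ) + j < k then i + j + n - k else if (i : ℕ) + j < n + k then i + j - k
    else i + j - k - n, by split_ifs <;> omega⟩

/-- The sign picked up by `k` under `reflect i j` when the edge joining `n - 1` to `0` has sign
`ε`. -/
def reflectSign {n : ℕ} (ε : ℝ) (i j k : Fin n) : ℝ :=
  if (i : ℕ) + j < k ∨ n + k ≤ (i : ℕ) + j then ε else 1

theorem reflect_reflect {n : ℕ} (i j k : Fin n) : reflect i j (reflect i j k) = k := by
  ext
  simp only [reflect]
  split_ifs <;> omega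

theorem reflectSign_reflect {n : ℕ} (ε : ℝ) (i j k : Fin n) :
    reflectSign ε i j (reflect i j k) = reflectSign ε i j k := by
  simp only [reflectSign, reflect]
  congr 1
  rw [eq_iff_iff]
  split_ifs <;> omega

theorem reflectSign_mul_self {n : ℕ} {ε : ℝ} (hε : ε * ε = 1) (i j k : Fin n) :
    reflectSign ε i j k * reflectSign ε i j k = 1 := by
  simp only [reflectSign]
  split_ifs <;> simp [hε]

theorem cycleLaplacian_reflect {n : ℕ} (hn : 3 ≤ n) {ε : ℝ} (hε : ε * ε = 1) (i j k l : Fin n) :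
    cycleLaplacian n ε (reflect i j k) (reflect i j l) =
      reflectSign ε i j k * reflectSign ε i j l * cycleLaplacian n ε k l := by
  have hi := i.2
  have hj := j.2
  have hk := k.2
  have hl := l.2
  simp only [cycleLaplacian, of_apply, Fin.ext_iff, reflect, reflectSign]
  by_cases h1 : (i : ℕ) + j < k <;> by_cases h2 : (i : ℕ) + j < l <;>
  by_cases h3 : (i : ℕ) + j < n + k <;> by_cases h4 : (i : ℕ) + j < n + l <;>
  first
  | (exfalso; omega)
  | (simp only [h1, h2, if_true, if_false, h3, h4, not_le.mpr, false_or, or_false]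
     split_ifs <;> first | (exfalso; omega) | simp [hε])

theorem exists_signed_reflection {n : ℕ} (hn : 3 ≤ n) {ε η : ℝ} (hε : ε * ε = 1) (hη : η * η = 1)
    (i j : Fin n) : ∃ P : Matrix (Fin n) (Fin n) ℝ, Pᵀ = P ∧ P * P = 1 ∧
      P * cycleLaplacian n ε = cycleLaplacian n ε * P ∧
      P *ᵥ Pi.single i 1 = η • Pi.single j 1 := by
  have hr : ∀ k l, k = reflect i j l ↔ l = reflect i j k := fun k l =>
    ⟨fun h => by rw [h, reflect_reflect], fun h => by rw [h, reflect_reflect]⟩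
  refine ⟨Matrix.of fun k l => if k = reflect i j l then η * reflectSign ε i j l else 0,
    ?_, ?_, ?_, ?_⟩
  · ext k l
    simp only [transpose_apply, of_apply]
    simp only [hr l k]
    split_ifs with h
    · rw [h, reflectSign_reflect]
    · rfl
  · ext k l
    simp only [mul_apply, of_apply, hr k, ite_mul, zero_mul, Finset.sum_ite_eq', Finset.mem_univ,
      if_true, one_apply]
    simp only [hr (reflect i j k), reflect_reflect, reflectSign_reflect]
    split_ifs with h1 h2 h2
    · subst h1
      linear_combination (reflectSign ε i j l * reflectSign ε i j l) * hη +
        reflectSign_mul_self hε i j l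
    · exact absurd h1.symm h2
    · exact absurd h2.symm h1
    · simp
  · ext k l
    have h := cycleLaplacian_reflect hn hε i j k (reflect i j l)
    rw [reflect_reflect, reflectSign_reflect] at h
    have h2 := reflectSign_mul_self hε i j l
    have h3 := reflectSign_mul_self hε i j k
    simp only [mul_apply, of_apply, mul_ite, mul_zero, Finset.sum_ite_eq', Finset.mem_univ, if_true]
    simp only [hr k, ite_mul, zero_mul, Finset.sum_ite_eq', Finset.mem_univ, if_true]
    rw [h, reflectSign_reflect]
    linear_combination (η * reflectSign ε i j l * cycleLaplacian n ε k (reflect i j l)) * h3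
  · ext k
    have h : reflect i j i = j := by
      ext; simp only [reflect]; split_ifs <;> omega
    have h' : reflectSign ε i j i = 1 := by
      simp only [reflectSign]
      rw [if_neg]; omega
    simp [h, h', Pi.single_apply]

theorem SignedGraph.ext_sign {V : Type*} {Γ Δ : SignedGraph V}
    (h : ∀ x y, Γ.sign x y = Δ.sign x y) : Γ = Δ := by
  have hg : Γ.graph = Δ.graph := by
    ext x y
    rw [← Γ.sign_ne_zero, ← Δ.sign_ne_zero, h]
  have hs : Γ.sign = Δ.sign := funext fun x => funext fun y => h x y
  cases Γ
  cases Δ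
  simp_all

theorem cycleGraph_adj_iff {n : ℕ} (hn : 3 ≤ n) (k l : Fin n) :
    (SimpleGraph.cycleGraph n).Adj k l ↔ ((k : ℕ) + 1 = l ∨ (l : ℕ) + 1 = k) ∨
      ((k : ℕ) = 0 ∧ (l : ℕ) + 1 = n) ∨ ((l : ℕ) = 0 ∧ (k : ℕ) + 1 = n) := by
  have hk := k.2
  have hl := l.2
  rw [SimpleGraph.cycleGraph_adj']
  rcases lt_trichotomy k l with h | rfl | h
  · rw [Fin.coe_sub_iff_lt.2 h, Fin.coe_sub_iff_le.2 h.le]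
    rw [Fin.lt_def] at h
    omega
  · rw [Fin.coe_sub_iff_le.2 le_rfl]
    omega
  · rw [Fin.coe_sub_iff_lt.2 h, Fin.coe_sub_iff_le.2 h.le]
    rw [Fin.lt_def] at h
    omega

theorem sign_twoCycles_inl_inl {n : ℕ} (hn : 3 ≤ n) (k l : Fin n) :
    (twoCycles n).sign (Sum.inl k) (Sum.inl l) =
      if ((k : ℕ) + 1 = l ∨ (l : ℕ) + 1 = k) ∨
        ((k : ℕ) = 0 ∧ (l : ℕ) + 1 = n) ∨ ((l : ℕ) = 0 ∧ (k : ℕ) + 1 = n) then 1 else 0 := by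
  simp only [← cycleGraph_adj_iff hn]
  rfl

theorem sign_twoCycles_inr_inr {n : ℕ} (hn : 3 ≤ n) (k l : Fin n) :
    (twoCycles n).sign (Sum.inr k) (Sum.inr l) =
      if ((k : ℕ) + 1 = l ∨ (l : ℕ) + 1 = k) ∨
        ((k : ℕ) = 0 ∧ (l : ℕ) + 1 = n) ∨ ((l : ℕ) = 0 ∧ (k : ℕ) + 1 = n) then 1 else 0 := by
  simp only [← cycleGraph_adj_iff hn]
  rfl

theorem sign_twoCycles_inl_inr {n : ℕ} (k l : Fin n) :
    (twoCycles n).sign (Sum.inl k) (Sum.inr l) = 0 := rfl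

theorem sign_twoCycles_inr_inl {n : ℕ} (k l : Fin n) :
    (twoCycles n).sign (Sum.inr k) (Sum.inl l) = 0 := rfl

theorem laplacian_twoCycles {n : ℕ} (hn : 3 ≤ n) :
    (twoCycles n).laplacian = fromBlocks (cycleLaplacian n 1) 0 0 (cycleLaplacian n 1) := by
  have hsum : ∀ k : Fin n, ∑ l : Fin n, ((if ((k : ℕ) + 1 = l ∨ (l : ℕ) + 1 = k) ∨
      ((k : ℕ) = 0 ∧ (l : ℕ) + 1 = n) ∨ ((l : ℕ) = 0 ∧ (k : ℕ) + 1 = n) then 1 else 0 :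
        SignType) : ℝ) ^ 2 = 2 := by
    intro k
    simp only [← cycleGraph_adj_iff hn]
    obtain ⟨m, rfl⟩ := Nat.exists_eq_add_of_le' hn
    have h := SimpleGraph.cycleGraph_degree_three_le (n := m) (v := k)
    rw [← SimpleGraph.card_neighborFinset_eq_degree, SimpleGraph.neighborFinset_eq_filter,
      Finset.card_filter] at h
    have h' := congrArg (Nat.cast : ℕ → ℝ) h
    rw [Nat.cast_sum, Nat.cast_ofNat] at h'
    rw [← h']
    refine Finset.sum_congr rfl fun l _ => ?_
    split_ifs <;> simp
  ext (k | k) (l | l)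
  · rw [fromBlocks_apply₁₁]
    simp only [laplacian_apply, Fintype.sum_sum_type, sign_twoCycles_inl_inl hn,
      sign_twoCycles_inl_inr, hsum, cycleLaplacian, of_apply, Sum.inl.injEq]
    split_ifs <;> first | (exfalso; tauto) | simp
  · simp [laplacian_apply, sign_twoCycles_inl_inr]
  · simp [laplacian_apply, sign_twoCycles_inr_inl]
  · rw [fromBlocks_apply₂₂]
    simp only [laplacian_apply, Fintype.sum_sum_type, sign_twoCycles_inr_inr hn,
      sign_twoCycles_inr_inl, hsum, cycleLaplacian, of_apply, Sum.inr.injEq]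
    split_ifs <;> first | (exfalso; tauto) | simp

theorem partialTranspose_gamma1 {n : ℕ} (i j : Fin n) :
    (gamma1 i j).partialTranspose =
      (((twoCycles n).addPos (u i) (u j)).addNeg (u i) (v i)).addPos (u j) (v i) := by
  apply ext_sign
  have e : ∀ {V : Type} (s : V → V → SignType) h1 h2, (ofSign s h1 h2).sign = s :=
    fun _ _ _ => rfl
  rintro (k | k) (l | l) <;>
  simp only [partialTranspose, e, gamma1, addPos, addNeg, sign_setSign, Sym2.eq_iff, u, v,
    sign_twoCycles_inl_inr, sign_twoCycles_inr_inl, reduceCtorEq, Sum.inl.injEq, Sum.inr.injEq,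
    and_false, false_and, or_false, false_or, if_false, ne_eq, not_false_eq_true, true_and,
    and_comm]

theorem laplacian_gamma1 {n : ℕ} {i j : Fin n} (hij : i < j)
    (hadj : ¬ (twoCycles n).graph.Adj (u i) (u j)) :
    (gamma1 i j).laplacian = (twoCycles n).laplacian + edgeLaplacian (Sum.inl i) (Sum.inl j) 1 +
      edgeLaplacian (Sum.inl i) (Sum.inr i) (-1) + edgeLaplacian (Sum.inl i) (Sum.inr j) 1 := by
  have hs : (twoCycles n).sign (Sum.inl i) (Sum.inl j) = 0 := by
    rw [← (twoCycles n).sign_ne_zero, not_not] at hadj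
    exact hadj
  have hij' := hij.ne
  rw [gamma1, addPos, addPos, addNeg, laplacian_setSign _ (by simp), laplacian_setSign _ (by simp),
    laplacian_setSign _ (by simpa using hij')]
  simp [sign_setSign, hs, sign_twoCycles_inl_inr, edgeLaplacian_zero, hij'.symm]

theorem laplacian_partialTranspose_gamma1 {n : ℕ} {i j : Fin n} (hij : i < j)
    (hadj : ¬ (twoCycles n).graph.Adj (u i) (u j)) :
    (gamma1 i j).partialTranspose.laplacian = (twoCycles n).laplacian +
      edgeLaplacian (Sum.inl i) (Sum.inl j) 1 + edgeLaplacian (Sum.inl i) (Sum.inr i) (-1) +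
      edgeLaplacian (Sum.inl j) (Sum.inr i) 1 := by
  have hs : (twoCycles n).sign (Sum.inl i) (Sum.inl j) = 0 := by
    rw [← (twoCycles n).sign_ne_zero, not_not] at hadj
    exact hadj
  have hij' := hij.ne
  rw [partialTranspose_gamma1, addPos, addPos, addNeg, laplacian_setSign _ (by simp),
    laplacian_setSign _ (by simp), laplacian_setSign _ (by simpa using hij')]
  simp [sign_setSign, hs, sign_twoCycles_inl_inr, edgeLaplacian_zero, hij'.symm]

theorem SignedGraph.laplacian_resign_two {V : Type*} [Fintype V] [DecidableEq V]
    (Γ : SignedGraph V) {a b c d : V} (hab : a ≠ b) (hcd : c ≠ d) (h : s(a, b) ≠ s(c, d)) :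
    ((((Γ.deleteEdge a b).deleteEdge c d).addNeg a b).addNeg c d).laplacian = Γ.laplacian +
      (edgeLaplacian a b (-1) - edgeLaplacian a b (Γ.sign a b : ℝ)) +
      (edgeLaplacian c d (-1) - edgeLaplacian c d (Γ.sign c d : ℝ)) := by
  simp only [deleteEdge, addNeg, laplacian_setSign _ hab, laplacian_setSign _ hcd, sign_setSign,
    h, h.symm, hab, hcd, ne_eq, not_false_eq_true, and_true, and_false, if_true, if_false,
    SignType.coe_zero, SignType.coe_neg_one, edgeLaplacian_zero]
  abel

theorem SignedGraph.laplacian_resign_three {V : Type*} [Fintype V] [DecidableEq V]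
    (Γ : SignedGraph V) {a b c d e f : V} (hab : a ≠ b) (hcd : c ≠ d) (hef : e ≠ f)
    (h₁ : s(a, b) ≠ s(c, d)) (h₂ : s(a, b) ≠ s(e, f)) (h₃ : s(c, d) ≠ s(e, f)) :
    ((((((Γ.deleteEdge a b).deleteEdge c d).deleteEdge e f).addNeg a b).addPos c d).addNeg
      e f).laplacian = Γ.laplacian +
      (edgeLaplacian a b (-1) - edgeLaplacian a b (Γ.sign a b : ℝ)) +
      (edgeLaplacian c d 1 - edgeLaplacian c d (Γ.sign c d : ℝ)) +
      (edgeLaplacian e f (-1) - edgeLaplacian e f (Γ.sign e f : ℝ)) := by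
  simp only [deleteEdge, addNeg, addPos, laplacian_setSign _ hab, laplacian_setSign _ hcd,
    laplacian_setSign _ hef, sign_setSign, h₁, h₁.symm, h₂, h₂.symm, h₃, h₃.symm, hab, hcd, hef,
    ne_eq, not_false_eq_true, and_true, and_false, if_true, if_false, SignType.coe_zero,
    SignType.coe_one, SignType.coe_neg_one, edgeLaplacian_zero]
  abel

theorem edgeLaplacian_neg_one_sub_one_apply {V : Type*} [DecidableEq V] (a b x y : V) :
    (edgeLaplacian a b (-1) - edgeLaplacian a b 1) x y =
      if x ≠ y ∧ ((x = a ∧ y = b) ∨ (x = b ∧ y = a)) then 2 else 0 := by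
  simp only [Matrix.sub_apply, edgeLaplacian, of_apply]
  by_cases hxy : x = y
  · simp [hxy]
  · by_cases h : (x = a ∧ y = b) ∨ (x = b ∧ y = a)
    · rw [if_neg hxy, if_pos h, if_neg hxy, if_pos h, if_pos ⟨hxy, h⟩]
      norm_num
    · rw [if_neg hxy, if_neg h, if_neg hxy, if_neg h, if_neg fun h' => h h'.2]
      norm_num

theorem SignedGraph.not_isomorphic_of_laplacian {ι : Type*} [Fintype ι] [DecidableEq ι]
    {Γ Δ : SignedGraph (ι ⊕ ι)} {B : Matrix (ι ⊕ ι) (ι ⊕ ι) ℝ} (hB : ∀ x, B x x = 2) {i j : ι}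
    (hij : i ≠ j) {α : ℝ} (hα : α ^ 2 = 1)
    (hΓ : Γ.laplacian = B + edgeLaplacian (Sum.inl i) (Sum.inl j) 1 +
      edgeLaplacian (Sum.inl i) (Sum.inr i) α + edgeLaplacian (Sum.inl i) (Sum.inr j) 1)
    (hΔ : Δ.laplacian = B + edgeLaplacian (Sum.inl i) (Sum.inl j) 1 +
      edgeLaplacian (Sum.inl i) (Sum.inr i) (-1) + edgeLaplacian (Sum.inl j) (Sum.inr i) 1) :
    ¬ Γ.Isomorphic Δ := by
  intro h
  obtain ⟨y, hy⟩ := h.exists_laplacian_diag (Sum.inl i)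
  rw [hΓ, hΔ] at hy
  simp only [Matrix.add_apply, hB, edgeLaplacian, of_apply, if_true, hα] at hy
  rcases y with y | y
  · by_cases h₁ : y = i
    · subst h₁
      simp [hij] at hy
    · by_cases h₂ : y = j
      · subst h₂
        simp [hij, hij.symm] at hy
      · simp [h₁, h₂, hij] at hy
        norm_num at hy
  · by_cases h₁ : y = i
    · simp [h₁, hij] at hy
    · simp [h₁, hij] at hy
      norm_num at hy

theorem charpoly_eq_of_switching {n : ℕ} (hn : 3 ≤ n) {i j : Fin n} (hij : i ≠ j)
    {B : Matrix (Fin n ⊕ Fin n) (Fin n ⊕ Fin n) ℝ} {ε η α : ℝ} (hε : ε * ε = 1) (hη : η * η = 1)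
    {d d' : Fin n ⊕ Fin n → ℝ} (hd : ∀ x, d x * d x = 1) (hd' : ∀ x, d' x * d' x = 1)
    (hB : diagonal d * B * diagonal d =
      fromBlocks (cycleLaplacian n ε) 0 0 (cycleLaplacian n ε))
    (hB' : diagonal d' * B * diagonal d' =
      fromBlocks (cycleLaplacian n ε) 0 0 (cycleLaplacian n ε))
    (h₁ : d (Sum.inl i) * d (Sum.inl j) = η) (h₂ : d (Sum.inl i) * d (Sum.inr i) * α = -1)
    (h₃ : d (Sum.inl i) * d (Sum.inr j) = η) (h₁' : d' (Sum.inl i) * d' (Sum.inl j) = η)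
    (h₂' : d' (Sum.inl i) * d' (Sum.inr i) = 1) (h₃' : d' (Sum.inl j) * d' (Sum.inr i) = η) :
    (B + edgeLaplacian (Sum.inl i) (Sum.inl j) 1 + edgeLaplacian (Sum.inl i) (Sum.inr i) α +
      edgeLaplacian (Sum.inl i) (Sum.inr j) 1).charpoly =
    (B + edgeLaplacian (Sum.inl i) (Sum.inl j) 1 + edgeLaplacian (Sum.inl i) (Sum.inr i) (-1) +
      edgeLaplacian (Sum.inl j) (Sum.inr i) 1).charpoly := by
  obtain ⟨P, hPT, hPP, hPY, hPi⟩ := exists_signed_reflection hn hε hη i j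
  have key := charpoly_interchange hPT hPP hPY hij (by rw [pow_two, hη]) hPi
  have hdd : diagonal d * diagonal d = 1 := by
    rw [diagonal_mul_diagonal, ← diagonal_one]
    congr 1
    exact funext hd
  have hdd' : diagonal d' * diagonal d' = 1 := by
    rw [diagonal_mul_diagonal, ← diagonal_one]
    congr 1
    exact funext hd'
  have hu : (Sum.inl i : Fin n ⊕ Fin n) ≠ Sum.inl j := by simpa using hij
  have hui : (Sum.inl i : Fin n ⊕ Fin n) ≠ Sum.inr i := by simp
  have hvj : (Sum.inl i : Fin n ⊕ Fin n) ≠ Sum.inr j := by simp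
  have huj : (Sum.inl j : Fin n ⊕ Fin n) ≠ Sum.inr i := by simp
  refine (charpoly_eq_of_conj hdd ?_).trans
    (key.trans (charpoly_eq_of_conj hdd' ?_).symm)
  · simp only [Matrix.mul_add, Matrix.add_mul, hB, diagonal_mul_edgeLaplacian_mul_diagonal hu _ hd,
      diagonal_mul_edgeLaplacian_mul_diagonal hui _ hd,
      diagonal_mul_edgeLaplacian_mul_diagonal hvj _ hd, h₁, h₂, h₃, mul_one]
  · simp only [Matrix.mul_add, Matrix.add_mul, hB',
      diagonal_mul_edgeLaplacian_mul_diagonal hu _ hd',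
      diagonal_mul_edgeLaplacian_mul_diagonal hui _ hd',
      diagonal_mul_edgeLaplacian_mul_diagonal huj _ hd', h₁', h₂', h₃', mul_one, one_mul]

/-- The switching function that is `-1` on the labels from `j` to `n - 2`. -/
def switchBetween {n : ℕ} (j k : Fin n) : ℝ :=
  if j ≤ k ∧ (k : ℕ) + 1 < n then -1 else 1

/-- The switching function that is `-1` on the labels from `j` on. -/
def switchFrom {n : ℕ} (j k : Fin n) : ℝ := if j ≤ k then -1 else 1

theorem switch_cycleLaplacian_between {n : ℕ} (hn : 3 ≤ n) {j : Fin n} (hj : 0 < (j : ℕ))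
    (hjn : (j : ℕ) + 1 < n) (k l : Fin n) :
    switchBetween j k * (cycleLaplacian n 1 k l +
      (edgeLaplacian (secondLast j) (last j) (-1) - edgeLaplacian (secondLast j) (last j) 1) k l +
      (edgeLaplacian (prev j) j (-1) - edgeLaplacian (prev j) j 1) k l) * switchBetween j l =
      cycleLaplacian n 1 k l := by
  have hk := k.2
  have hl := l.2
  simp only [edgeLaplacian_neg_one_sub_one_apply, cycleLaplacian, of_apply, switchBetween,
    Fin.ext_iff, Fin.le_def, ne_eq]
  by_cases h1 : (j : ℕ) ≤ k ∧ (k : ℕ) + 1 < n <;> by_cases h2 : (j : ℕ) ≤ l ∧ (l : ℕ) + 1 < n <;>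
  simp only [h1, h2, and_self, if_true, if_false] <;> split_ifs <;>
  first
  | (exfalso; omega)
  | norm_num

theorem switch_cycleLaplacian_from {n : ℕ} (hn : 3 ≤ n) {j : Fin n} (hj : 0 < (j : ℕ))
    (k l : Fin n) :
    switchFrom j k * (cycleLaplacian n 1 k l +
      (edgeLaplacian (prev j) j (-1) - edgeLaplacian (prev j) j 1) k l) * switchFrom j l =
      cycleLaplacian n (-1) k l := by
  have hk := k.2
  have hl := l.2
  simp only [edgeLaplacian_neg_one_sub_one_apply, cycleLaplacian, of_apply, switchFrom,
    Fin.ext_iff, Fin.le_def, ne_eq]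
  by_cases h1 : (j : ℕ) ≤ k <;> by_cases h2 : (j : ℕ) ≤ l <;>
  simp only [h1, h2, if_true, if_false] <;> split_ifs <;>
  first
  | (exfalso; omega)
  | norm_num

theorem edgeLaplacian_inl {ι : Type*} [DecidableEq ι] (a b : ι) (ε : ℝ) :
    edgeLaplacian (Sum.inl a : ι ⊕ ι) (Sum.inl b) ε = fromBlocks (edgeLaplacian a b ε) 0 0 0 := by
  ext (k | k) (l | l) <;> simp [edgeLaplacian]

theorem edgeLaplacian_inr {ι : Type*} [DecidableEq ι] (a b : ι) (ε : ℝ) :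
    edgeLaplacian (Sum.inr a : ι ⊕ ι) (Sum.inr b) ε = fromBlocks 0 0 0 (edgeLaplacian a b ε) := by
  ext (k | k) (l | l) <;> simp [edgeLaplacian]

/-- Two negative edges in one of the cycles are removed by switching. -/
theorem switch_twoCycles_balanced {n : ℕ} (hn : 3 ≤ n) {i j : Fin n} (hj : 0 < (j : ℕ))
    (hjn : (j : ℕ) + 1 < n) {s : ℝ} (hs : s * s = 1) :
    diagonal (Sum.elim (switchBetween j) fun _ => s) * ((twoCycles n).laplacian +
      (edgeLaplacian (u (secondLast i)) (u (last i)) (-1) -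
        edgeLaplacian (u (secondLast i)) (u (last i)) 1) +
      (edgeLaplacian (u (prev j)) (u j) (-1) - edgeLaplacian (u (prev j)) (u j) 1)) *
      diagonal (Sum.elim (switchBetween j) fun _ => s) =
    fromBlocks (cycleLaplacian n 1) 0 0 (cycleLaplacian n 1) := by
  rw [laplacian_twoCycles hn]
  simp only [edgeLaplacian_inl]
  ext (k | k) (l | l)
  · rw [mul_diagonal, diagonal_mul]
    exact switch_cycleLaplacian_between hn hj hjn k l
  · simp [mul_diagonal, diagonal_mul]
  · simp [mul_diagonal, diagonal_mul]
  · simp only [mul_diagonal, diagonal_mul, Matrix.add_apply, Matrix.sub_apply, fromBlocks_apply₂₂,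
      Matrix.zero_apply, Sum.elim_inr]
    linear_combination (cycleLaplacian n 1 k l) * hs

/-- One negative edge in each cycle is moved by switching to the edge joining the last label to the
first. -/
theorem switch_twoCycles_unbalanced {n : ℕ} (hn : 3 ≤ n) {i j : Fin n} (hj : 0 < (j : ℕ))
    {s : ℝ} (hs : s * s = 1) :
    diagonal (Sum.elim (switchFrom j) fun k => s * switchFrom (last i) k) *
      ((twoCycles n).laplacian +
      (edgeLaplacian (v (secondLast i)) (v (last i)) (-1) -
        edgeLaplacian (v (secondLast i)) (v (last i)) 1) +
      (edgeLaplacian (u (prev j)) (u j) (-1) - edgeLaplacian (u (prev j)) (u j) 1)) *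
      diagonal (Sum.elim (switchFrom j) fun k => s * switchFrom (last i) k) =
    fromBlocks (cycleLaplacian n (-1)) 0 0 (cycleLaplacian n (-1)) := by
  rw [laplacian_twoCycles hn]
  simp only [edgeLaplacian_inl, edgeLaplacian_inr]
  ext (k | k) (l | l)
  · rw [mul_diagonal, diagonal_mul]
    have := switch_cycleLaplacian_from hn hj k l
    simpa using this
  · simp [mul_diagonal, diagonal_mul]
  · simp [mul_diagonal, diagonal_mul]
  · have h := switch_cycleLaplacian_from hn (j := last i) (show 0 < n - 1 by omega) k l
    have e : prev (last i) = secondLast i := Fin.ext (by simp only; omega)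
    rw [e] at h
    simp only [mul_diagonal, diagonal_mul, Matrix.add_apply, Matrix.sub_apply, fromBlocks_apply₂₂,
      Matrix.zero_apply, Sum.elim_inr] at h ⊢
    linear_combination (s * s) * h + (cycleLaplacian n (-1) k l) * hs

theorem laplacian_twoCycles_diag {n : ℕ} (hn : 3 ≤ n) (x : Fin n ⊕ Fin n) :
    (twoCycles n).laplacian x x = 2 := by
  rw [laplacian_twoCycles hn]
  rcases x with x | x <;> simp [cycleLaplacian]

theorem laplacian_gamma2 {n : ℕ} (hn : 3 ≤ n) {i j : Fin n} (hij : i < j)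
    (hadj : ¬ (twoCycles n).graph.Adj (u i) (u j)) (hjn : (j : ℕ) + 1 < n) :
    (gamma2 i j).laplacian = (twoCycles n).laplacian +
      (edgeLaplacian (u (secondLast i)) (u (last i)) (-1) -
        edgeLaplacian (u (secondLast i)) (u (last i)) 1) +
      (edgeLaplacian (u (prev j)) (u j) (-1) - edgeLaplacian (u (prev j)) (u j) 1) +
      edgeLaplacian (Sum.inl i) (Sum.inl j) 1 + edgeLaplacian (Sum.inl i) (Sum.inr i) 1 +
      edgeLaplacian (Sum.inl i) (Sum.inr j) 1 := by
  have hij' : (i : ℕ) < j := hij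
  have hadj' : (i : ℕ) + 1 ≠ j := fun h => hadj (by
    rw [← sign_ne_zero, sign_twoCycles_inl_inl hn, if_pos (Or.inl (Or.inl h))]
    exact one_ne_zero)
  rw [gamma2, laplacian_resign_three _ ?_ ?_ ?_ ?_ ?_ ?_, laplacian_gamma1 hij hadj]
  · have e₁ : (gamma1 i j).sign (u (secondLast i)) (u (last i)) = 1 := by
      simp [gamma1, addPos, addNeg, sign_setSign, sign_twoCycles_inl_inl hn, Fin.ext_iff]
      omega
    have e₂ : (gamma1 i j).sign (u i) (v i) = -1 := by
      simp [gamma1, addPos, addNeg, sign_setSign, hij.ne]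
    have e₃ : (gamma1 i j).sign (u (prev j)) (u j) = 1 := by
      simp [gamma1, addPos, addNeg, sign_setSign, sign_twoCycles_inl_inl hn, Fin.ext_iff]
      omega
    rw [e₁, e₂, e₃, SignType.coe_one, SignType.coe_neg_one]
    abel
  all_goals simp [Fin.ext_iff]
  all_goals omega

theorem laplacian_gamma3 {n : ℕ} (hn : 3 ≤ n) {i j : Fin n} (hij : i < j)
    (hadj : ¬ (twoCycles n).graph.Adj (u i) (u j)) (hjn : (j : ℕ) + 1 < n) :
    (gamma3 i j).laplacian = (twoCycles n).laplacian +
      (edgeLaplacian (u (secondLast i)) (u (last i)) (-1) -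
        edgeLaplacian (u (secondLast i)) (u (last i)) 1) +
      (edgeLaplacian (u (prev j)) (u j) (-1) - edgeLaplacian (u (prev j)) (u j) 1) +
      edgeLaplacian (Sum.inl i) (Sum.inl j) 1 + edgeLaplacian (Sum.inl i) (Sum.inr i) (-1) +
      edgeLaplacian (Sum.inl j) (Sum.inr i) 1 := by
  have hij' : (i : ℕ) < j := hij
  have hadj' : (i : ℕ) + 1 ≠ j := fun h => hadj (by
    rw [← sign_ne_zero, sign_twoCycles_inl_inl hn, if_pos (Or.inl (Or.inl h))]
    exact one_ne_zero)
  rw [gamma3, laplacian_resign_two _ ?_ ?_ ?_, laplacian_partialTranspose_gamma1 hij hadj,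
    partialTranspose_gamma1]
  · have e₁ : ((((twoCycles n).addPos (u i) (u j)).addNeg (u i) (v i)).addPos (u j) (v i)).sign
        (u (secondLast i)) (u (last i)) = 1 := by
      simp [addPos, addNeg, sign_setSign, sign_twoCycles_inl_inl hn, Fin.ext_iff]
      omega
    have e₃ : ((((twoCycles n).addPos (u i) (u j)).addNeg (u i) (v i)).addPos (u j) (v i)).sign
        (u (prev j)) (u j) = 1 := by
      simp [addPos, addNeg, sign_setSign, sign_twoCycles_inl_inl hn, Fin.ext_iff]
      omega
    rw [e₁, e₃, SignType.coe_one]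
    abel
  all_goals simp [Fin.ext_iff]
  all_goals omega

theorem laplacian_gamma4 {n : ℕ} (hn : 3 ≤ n) {i j : Fin n} (hij : i < j)
    (hadj : ¬ (twoCycles n).graph.Adj (u i) (u j)) :
    (gamma4 i j).laplacian = (twoCycles n).laplacian +
      (edgeLaplacian (v (secondLast i)) (v (last i)) (-1) -
        edgeLaplacian (v (secondLast i)) (v (last i)) 1) +
      (edgeLaplacian (u (prev j)) (u j) (-1) - edgeLaplacian (u (prev j)) (u j) 1) +
      edgeLaplacian (Sum.inl i) (Sum.inl j) 1 + edgeLaplacian (Sum.inl i) (Sum.inr i) 1 +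
      edgeLaplacian (Sum.inl i) (Sum.inr j) 1 := by
  have hij' : (i : ℕ) < j := hij
  have hadj' : (i : ℕ) + 1 ≠ j := fun h => hadj (by
    rw [← sign_ne_zero, sign_twoCycles_inl_inl hn, if_pos (Or.inl (Or.inl h))]
    exact one_ne_zero)
  rw [gamma4, laplacian_resign_three _ ?_ ?_ ?_ ?_ ?_ ?_, laplacian_gamma1 hij hadj]
  · have e₁ : (gamma1 i j).sign (v (secondLast i)) (v (last i)) = 1 := by
      simp [gamma1, addPos, addNeg, sign_setSign, sign_twoCycles_inr_inr hn]
      omega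
    have e₂ : (gamma1 i j).sign (u i) (v i) = -1 := by
      simp [gamma1, addPos, addNeg, sign_setSign, hij.ne]
    have e₃ : (gamma1 i j).sign (u (prev j)) (u j) = 1 := by
      simp [gamma1, addPos, addNeg, sign_setSign, sign_twoCycles_inl_inl hn, Fin.ext_iff]
      omega
    rw [e₁, e₂, e₃, SignType.coe_one, SignType.coe_neg_one]
    abel
  all_goals simp [Fin.ext_iff]
  all_goals omega

theorem laplacian_gamma5 {n : ℕ} (hn : 3 ≤ n) {i j : Fin n} (hij : i < j)
    (hadj : ¬ (twoCycles n).graph.Adj (u i) (u j)) :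
    (gamma5 i j).laplacian = (twoCycles n).laplacian +
      (edgeLaplacian (v (secondLast i)) (v (last i)) (-1) -
        edgeLaplacian (v (secondLast i)) (v (last i)) 1) +
      (edgeLaplacian (u (prev j)) (u j) (-1) - edgeLaplacian (u (prev j)) (u j) 1) +
      edgeLaplacian (Sum.inl i) (Sum.inl j) 1 + edgeLaplacian (Sum.inl i) (Sum.inr i) (-1) +
      edgeLaplacian (Sum.inl j) (Sum.inr i) 1 := by
  have hij' : (i : ℕ) < j := hij
  have hadj' : (i : ℕ) + 1 ≠ j := fun h => hadj (by
    rw [← sign_ne_zero, sign_twoCycles_inl_inl hn, if_pos (Or.inl (Or.inl h))]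
    exact one_ne_zero)
  rw [gamma5, laplacian_resign_two _ ?_ ?_ ?_, laplacian_partialTranspose_gamma1 hij hadj,
    partialTranspose_gamma1]
  · have e₁ : ((((twoCycles n).addPos (u i) (u j)).addNeg (u i) (v i)).addPos (u j) (v i)).sign
        (v (secondLast i)) (v (last i)) = 1 := by
      simp [addPos, addNeg, sign_setSign, sign_twoCycles_inr_inr hn]
      omega
    have e₃ : ((((twoCycles n).addPos (u i) (u j)).addNeg (u i) (v i)).addPos (u j) (v i)).sign
        (u (prev j)) (u j) = 1 := by
      simp [addPos, addNeg, sign_setSign, sign_twoCycles_inl_inl hn, Fin.ext_iff]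
      omega
    rw [e₁, e₃, SignType.coe_one]
    abel
  all_goals simp [Fin.ext_iff]
  all_goals omega

/-- `i`, `j` are labels of non-adjacent vertices `u_i`, `u_j` of the first cycle, with `i < j`. In
the last two parts `j` is not the last label, i.e. the edge `(u_{j-1}, u_j)` is not
`(u_{n-1}, u_n)`. -/
theorem theorem3p2 (n : ℕ) (hn : 3 ≤ n) (i j : Fin n) (hij : i < j)
    (hadj : ¬ (SignedGraph.twoCycles n).graph.Adj (SignedGraph.u i) (SignedGraph.u j)) :
    (¬ (SignedGraph.gamma1 i j).Isomorphic (SignedGraph.gamma1 i j).partialTranspose ∧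
      (SignedGraph.gamma1 i j).LaplacianCospectral (SignedGraph.gamma1 i j).partialTranspose) ∧
    ((j : ℕ) + 1 < n →
      ¬ (SignedGraph.gamma2 i j).Isomorphic (SignedGraph.gamma3 i j) ∧
      (SignedGraph.gamma2 i j).LaplacianCospectral (SignedGraph.gamma3 i j)) ∧
    ((j : ℕ) + 1 < n →
      ¬ (SignedGraph.gamma4 i j).Isomorphic (SignedGraph.gamma5 i j) ∧
      (SignedGraph.gamma4 i j).LaplacianCospectral (SignedGraph.gamma5 i j)) := by
  have hne : i ≠ j := hij.ne
  have hji : ¬ j ≤ i := not_le.2 hij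
  have hlt : (i : ℕ) < j := hij
  have hj : 0 < (j : ℕ) := by omega
  have h1 : ∀ j k : Fin n, switchBetween j k * switchBetween j k = 1 := fun j k => by
    simp only [switchBetween]; split_ifs <;> norm_num
  have h2 : ∀ j k : Fin n, switchFrom j k * switchFrom j k = 1 := fun j k => by
    simp only [switchFrom]; split_ifs <;> norm_num
  refine ⟨⟨?_, ?_⟩, fun hjn => ⟨?_, ?_⟩, fun hjn => ⟨?_, ?_⟩⟩
  · exact not_isomorphic_of_laplacian (laplacian_twoCycles_diag hn) hne (by norm_num)
      (laplacian_gamma1 hij hadj) (laplacian_partialTranspose_gamma1 hij hadj)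
  · rw [LaplacianCospectral, laplacianSpectrum, laplacianSpectrum, laplacian_gamma1 hij hadj,
      laplacian_partialTranspose_gamma1 hij hadj,
      charpoly_eq_of_switching hn hne (ε := 1) (η := 1) (d := fun _ => 1) (d' := fun _ => 1)] <;>
    simp [laplacian_twoCycles hn]
  · refine not_isomorphic_of_laplacian (fun x => ?_) hne (by norm_num)
      (laplacian_gamma2 hn hij hadj hjn) (laplacian_gamma3 hn hij hadj hjn)
    simp [edgeLaplacian_neg_one_sub_one_apply, laplacian_twoCycles_diag hn, -Matrix.sub_apply]
  · have hi' : switchBetween j i = 1 := by simp [switchBetween, hji]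
    have hj' : switchBetween j j = -1 := by simp [switchBetween, hjn]
    rw [LaplacianCospectral, laplacianSpectrum, laplacianSpectrum,
      laplacian_gamma2 hn hij hadj hjn, laplacian_gamma3 hn hij hadj hjn,
      charpoly_eq_of_switching hn hne (by norm_num) (η := -1) (by norm_num) ?_ ?_
        (switch_twoCycles_balanced hn (i := i) hj hjn (s := -1) (by norm_num))
        (switch_twoCycles_balanced hn (i := i) hj hjn (s := 1) (by norm_num))]
    any_goals simp [hi', hj', h1]
  · refine not_isomorphic_of_laplacian (fun x => ?_) hne (by norm_num)
      (laplacian_gamma4 hn hij hadj) (laplacian_gamma5 hn hij hadj)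
    simp [edgeLaplacian_neg_one_sub_one_apply, laplacian_twoCycles_diag hn, -Matrix.sub_apply]
  · have hi' : switchFrom j i = 1 := by simp [switchFrom, hji]
    have hj' : switchFrom j j = -1 := by simp [switchFrom]
    have hil : switchFrom (last i) i = 1 := by
      simp only [switchFrom, Fin.le_def]; rw [if_neg]; omega
    have hjl : switchFrom (last i) j = 1 := by
      simp only [switchFrom, Fin.le_def]; rw [if_neg]; omega
    rw [LaplacianCospectral, laplacianSpectrum, laplacianSpectrum,
      laplacian_gamma4 hn hij hadj, laplacian_gamma5 hn hij hadj,
      charpoly_eq_of_switching hn hne (by norm_num) (η := -1) (by norm_num) ?_ ?_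
        (switch_twoCycles_unbalanced hn (i := i) hj (s := -1) (by norm_num))
        (switch_twoCycles_unbalanced hn (i := i) hj (s := 1) (by norm_num))]
    any_goals simp [hi', hj', hil, hjl, h2]
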